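/- Let $n\ge 1$. Let $\tau$ be the cyclic permutation of $\{1,\dots,n\}$ with $\tau(1)=n$ and $\tau(i)=i-1$ for $2\le i\le n$. Equip $\mathbb{Z}^n$ with the associative multiplication $$(a*b)_i=a_i+b_{\tau^{a_i}(i)},\qquad 1\le i\le n,$$ whose identity is $(0,\dots,0)$, and let $\mathfrak{A}_n\subset\mathbb{Z}^n$ be the set of its invertible elements. Put $s=(0,n-1,n-2,\dots,2,1)$ and $a=(1,1,\dots,1)$, and for $1\le i\le n-1$ let $e_i\in\mathbb{R}^n$ be the vector with $i$-th coordinate $-(n-1)$ and all other coordinates $1$. Let $\Pi$ be the permutohedron, i.e. the convex hull of the $n!$ points obtained by permuting the coordinates of $(1,2,\dots,n)$, let $P=\{x+ta : x\in\Pi,\ 0\le t\le 1\}$ be the prism with base $\Pi$ and lateral edge $a$, and let $\Lambda$ be the set of integer linear combinations of $e_1,\dots,e_{n-1},a$. Then: 1. $s+\mathfrak{A}_n$ is the set of all $b\in\mathbb{Z}^n$ whose coordinates are pairwise incongruent modulo $n$. 2. $\Pi$ has dimension $n-1$, and $a$ is not parallel to the affine hull of $\Pi$ (so $P$ is a nondegenerate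 prism); the vectors $e_1,\dots,e_{n-1},a$ are linearly independent, so $\Lambda$ is a lattice of full rank in $\mathbb{R}^n$. 3. $s+\mathfrak{A}_n$ is exactly the set of all vertices of the prisms $v+P$, $v\in\Lambda$. 4. The prisms $v+P$, $v\in\Lambda$, form a face-to-face tessellation of $\mathbb{R}^n$: they are full-dimensional convex polytopes, form a locally finite family, cover $\mathbb{R}^n$, those for different $v$ have disjoint interiors, and any two of them meet in a common (possibly empty) face of both. -/

import Mathlib

open scoped Pointwise

/-- The set `ℤ^V` of integer-valued functions on a set `V` on which `ℤ` acts by the powers of a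
permutation `τ`. It is a type of its own because it carries the deformed multiplication below. -/
def DeformedMaps {V : Type*} (_τ : Equiv.Perm V) : Type _ := V → ℤ

/-- The deformed multiplication `(a * b)(v) = a(v) + b(v · τ ^ a(v))`; its identity is the zero
function. -/
instance DeformedMaps.instMonoid {V : Type*} (τ : Equiv.Perm V) : Monoid (DeformedMaps τ) where
  mul a b := fun v => a v + b ((τ ^ a v) v)
  one := fun _ => (0 : ℤ)
  one_mul a := by
    funext v
    change (0 : ℤ) + a ((τ ^ (0 : ℤ)) v) = a v
    simp
  mul_one a := by
    funext v
    change a v + (0 : ℤ) = a v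
    simp
  mul_assoc a b c := by
    funext v
    change a v + b ((τ ^ a v) v) + c ((τ ^ (a v + b ((τ ^ a v) v))) v)
      = a v + (b ((τ ^ a v) v) + c ((τ ^ b ((τ ^ a v) v)) ((τ ^ a v) v)))
    rw [add_assoc, ← Equiv.Perm.mul_apply, ← zpow_add, add_comm (b _) (a v)]

/-- The cyclic permutation `1 ↦ n`, `i ↦ i - 1` for `2 ≤ i ≤ n` (positions are numbered from `0`
in `Fin n`). -/
def cyclicPerm (n : ℕ) : Equiv.Perm (Fin n) := (finRotate n)⁻¹

/-- The set `𝔄ₙ ⊆ ℤⁿ` of invertible elements for the deformed multiplication given by the cyclic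
permutation. -/
def frakA (n : ℕ) : Set (Fin n → ℤ) :=
  {a | IsUnit (M := DeformedMaps (cyclicPerm n)) a}

/-- The translation vector `s = (0, n - 1, n - 2, …, 2, 1)`. -/
def shiftVec (n : ℕ) (i : Fin n) : ℤ := if (i : ℕ) = 0 then 0 else (n : ℤ) - (i : ℕ)

/-- The inclusion `ℤⁿ ⊆ ℝⁿ`. -/
def toReal {n : ℕ} (a : Fin n → ℤ) : Fin n → ℝ := fun i => (a i : ℝ)

/-- The `(n - 1)`-dimensional permutohedron: the convex hull of all points obtained by permuting
the coordinates of `(1, 2, …, n)`. -/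
def permutohedron (n : ℕ) : Set (Fin n → ℝ) :=
  convexHull ℝ (Set.range fun (σ : Equiv.Perm (Fin n)) (i : Fin n) => ((σ i : ℕ) : ℝ) + 1)

/-- The vector `(1, 1, …, 1)`. -/
def onesVec (n : ℕ) : Fin n → ℝ := fun _ => 1

/-- The vector `(1, …, 1, -(n - 1), 1, …, 1)`, with `-(n - 1)` in position `i`. -/
def eVec (n : ℕ) (i : Fin n) : Fin n → ℝ := fun j => if j = i then -((n : ℝ) - 1) else 1

/-- The `n` vectors `e₁, …, eₙ₋₁, (1, …, 1)`. -/
def latticeVec (n : ℕ) (i : Fin n) : Fin n → ℝ :=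
  if (i : ℕ) + 1 < n then eVec n i else onesVec n

/-- The integer combinations of `e₁, …, eₙ₋₁, (1, …, 1)`. -/
def prismLattice (n : ℕ) : AddSubgroup (Fin n → ℝ) :=
  AddSubgroup.closure (Set.range (latticeVec n))

/-- The prism `{x + t a : x ∈ B, 0 ≤ t ≤ 1}` with base `B` and lateral edge `a`. -/
def prism {E : Type*} [AddCommGroup E] [Module ℝ E] (B : Set E) (a : E) : Set E :=
  B + segment ℝ 0 a

/-- The prism with the permutohedron as base and lateral edge `(1, …, 1)`. -/
def permPrism (n : ℕ) : Set (Fin n → ℝ) := prism (permutohedron n) (onesVec n)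

/-- A face-to-face tessellation of a real vector space: a locally finite family of full-dimensional
convex polytopes that cover the space, have pairwise disjoint interiors, and such that any two of
them meet in a common (possibly empty) face of both. -/
structure IsFaceToFaceTessellation {E ι : Type*} [AddCommGroup E] [Module ℝ E]
    [TopologicalSpace E] (tile : ι → Set E) : Prop where
  polytope : ∀ i, ∃ F : Set E, F.Finite ∧ tile i = convexHull ℝ F
  fullDim : ∀ i, (interior (tile i)).Nonempty
  locallyFinite : LocallyFinite tile
  cover : ⋃ i, tile i = Set.univ
  disjointInteriors : ∀ i j, i ≠ j → Disjoint (interior (tile i)) (interior (tile j))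
  faceToFace : ∀ i j, i ≠ j →
    IsExposed ℝ (tile i) (tile i ∩ tile j) ∧ IsExposed ℝ (tile j) (tile i ∩ tile j)

/-! An element is invertible exactly when `v ↦ τ ^ a(v) v` is injective. Here `τ ^ a i` sends `i` to
`i - a i` mod `n`, and `s i ≡ -i`, so invertibility of `a` says that the coordinates of `s + a` are
distinct mod `n`.

The lattice consists of the integer vectors with all coordinates congruent mod `n`. The geometric
core is that each prism `v + P` is the Voronoi cell of `v` once the lattice is moved to the centre
of `P` (`vadd_permPrism_eq_latticeCell`); the tessellation is then the Voronoi tessellation.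

`P` lies in its cell because its vertices attain the minimal distance to the centre among integer
points with distinct residues, a set stable under lattice translations (`le_sqDist_prismCenter`).
Conversely, a point of the cell cannot be separated from `P`: for each linear functional some vertex
of `P` does at least as well, by summation by parts from the inequalities of the lattice vectors
`±(1, …, 1)` and `t (1, …, 1) - n 1_T` (`exists_vertex_sum_mul_le`).

The vertices of `P` lie on a sphere, hence are all extreme, and reduction mod `n` shows that their
translates are the points with distinct residues. -/

/-! ### Invertible elements and residues modulo `n`. -/

theorem finRotate_intModEq (n : ℕ) (i : Fin n) :
    ((finRotate n i : ℕ) : ℤ) ≡ (i : ℕ) + 1 [ZMOD n] := by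
  cases n with
  | zero => exact i.elim0
  | succ m =>
    rw [finRotate_apply, Fin.val_add]
    push_cast
    refine (Int.mod_modEq _ _).trans ?_
    refine Int.ModEq.add_left _ ?_
    rw [Fin.val_one']
    push_cast
    exact Int.mod_modEq _ _

theorem cyclicPerm_zpow_intModEq (n : ℕ) (k : ℤ) (i : Fin n) :
    (((cyclicPerm n ^ k) i : ℕ) : ℤ) ≡ (i : ℕ) - k [ZMOD n] := by
  have step : ∀ k : ℤ, (((cyclicPerm n ^ k) i : ℕ) : ℤ) ≡
      (((cyclicPerm n ^ (k + 1)) i : ℕ) : ℤ) + 1 [ZMOD n] := by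
    intro k
    have h := finRotate_intModEq n ((cyclicPerm n ^ (k + 1)) i)
    have e : finRotate n ((cyclicPerm n ^ (k + 1)) i) = (cyclicPerm n ^ k) i := by
      rw [add_comm, zpow_one_add, Equiv.Perm.mul_apply]
      exact Equiv.apply_symm_apply (finRotate n) _
    rwa [e] at h
  induction k using Int.induction_on with
  | zero => simp [Int.ModEq.refl]
  | succ m ih =>
    have h := ((step m).symm.trans ih).sub_right 1
    simpa [sub_sub] using h
  | pred m ih =>
    have h := (step (-(m : ℤ) - 1))
    rw [sub_add_cancel] at h
    have := h.trans (ih.add_right 1)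
    convert this using 1
    ring

theorem isUnit_deformedMaps_iff {V : Type*} [Finite V] (τ : Equiv.Perm V) (a : V → ℤ) :
    IsUnit (M := DeformedMaps τ) a ↔ Function.Injective fun v => (τ ^ a v) v := by
  constructor
  · rintro ⟨u, rfl⟩
    have h : ∀ v, u.val v + u.inv ((τ ^ u.val v) v) = 0 := fun v => congrFun u.val_inv v
    refine Function.LeftInverse.injective (g := fun v => (τ ^ u.inv v) v) fun v => ?_
    change (τ ^ u.inv ((τ ^ u.val v) v)) ((τ ^ u.val v) v) = v
    rw [← Equiv.Perm.mul_apply, ← zpow_add, add_comm, h v]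
    simp
  · intro h
    let e : V ≃ V := Equiv.ofBijective _ (Finite.injective_iff_bijective.mp h)
    have he : ∀ v, e v = (τ ^ a v) v := fun v => rfl
    -- The inverse undoes at `e w` the shift that `a` made at `w`.
    let b : V → ℤ := fun v => -a (e.symm v)
    refine ⟨⟨a, b, ?_, ?_⟩, rfl⟩
    · funext v
      change a v + -a (e.symm ((τ ^ a v) v)) = 0
      rw [← he, Equiv.symm_apply_apply, add_neg_cancel]
    · funext v
      obtain ⟨w, rfl⟩ := e.surjective v
      change -a (e.symm (e w)) + a ((τ ^ (-a (e.symm (e w)))) (e w)) = 0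
      rw [Equiv.symm_apply_apply, he, zpow_neg]
      exact (congrArg (_ + a ·) (Equiv.symm_apply_apply (τ ^ a w) w)).trans (neg_add_cancel _)

theorem shiftVec_intModEq (n : ℕ) (i : Fin n) : shiftVec n i ≡ -(i : ℕ) [ZMOD n] := by
  unfold shiftVec
  split_ifs with h
  · simp [h, Int.ModEq.refl]
  · rw [Int.modEq_iff_dvd]
    exact ⟨-1, by ring⟩

theorem Fin.eq_of_intModEq {n : ℕ} {i j : Fin n} (h : ((i : ℕ) : ℤ) ≡ (j : ℕ) [ZMOD n]) :
    i = j :=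
  Fin.ext (Nat.ModEq.eq_of_lt_of_lt (Int.natCast_modEq_iff.mp h) i.2 j.2)

theorem mem_frakA_iff (n : ℕ) (a : Fin n → ℤ) :
    a ∈ frakA n ↔ ∀ i j : Fin n, i ≠ j → ¬ shiftVec n i + a i ≡ shiftVec n j + a j [ZMOD n] := by
  have key : ∀ i, shiftVec n i + a i ≡ -(((cyclicPerm n ^ a i) i : ℕ) : ℤ) [ZMOD n] := by
    intro i
    refine ((shiftVec_intModEq n i).add_right _).trans ?_
    have := (cyclicPerm_zpow_intModEq n (a i) i).symm.neg
    convert this using 1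
    ring
  refine (isUnit_deformedMaps_iff (cyclicPerm n) a).trans ?_
  constructor
  · intro h i j hij hm
    refine hij (h (Fin.eq_of_intModEq ?_))
    simpa using ((key i).symm.trans (hm.trans (key j))).neg
  · intro h i j hij
    by_contra hne
    refine h i j hne ((key i).trans (.trans ?_ (key j).symm))
    simp only at hij
    rw [hij]

theorem shiftVec_add_image_frakA (n : ℕ) :
    (fun a : Fin n → ℤ => shiftVec n + a) '' frakA n =
      {b : Fin n → ℤ | ∀ i j : Fin n, i ≠ j → ¬ b i ≡ b j [ZMOD (n : ℤ)]} := by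
  ext b
  simp only [Set.mem_image, mem_frakA_iff, Set.mem_ofPred_eq]
  constructor
  · rintro ⟨a, ha, rfl⟩
    exact ha
  · intro h
    exact ⟨b - shiftVec n, by simpa using h, by simp⟩

/-! ### The lattice. -/

theorem latticeVec_apply (n : ℕ) (i j : Fin n) :
    latticeVec n i j = 1 - if (i : ℕ) + 1 < n ∧ j = i then (n : ℝ) else 0 := by
  unfold latticeVec
  by_cases h : (i : ℕ) + 1 < n
  · by_cases hj : j = i <;> simp [h, hj, eVec]
  · simp [h, onesVec]

theorem linearIndependent_latticeVec (n : ℕ) (hn : 1 ≤ n) : LinearIndependent ℝ (latticeVec n) := by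
  rw [Fintype.linearIndependent_iff]
  intro g hg
  let l : Fin n := ⟨n - 1, by omega⟩
  -- These are the coordinates of the relation; the last one gives `∑ g = 0`, and then the others
  -- give `g j = 0`.
  have hc : ∀ j : Fin n, ∑ i, g i - (if (j : ℕ) + 1 < n then g j * n else 0) = 0 := by
    intro j
    have h := congrFun hg j
    simp only [Finset.sum_apply, Pi.smul_apply, smul_eq_mul, latticeVec_apply, mul_sub, mul_one,
      Finset.sum_sub_distrib, Pi.zero_apply] at h
    rw [Finset.sum_eq_single (a := j) (s := Finset.univ) (f := fun i => g i * _)] at h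
    · simpa using h
    · intro b _ hb
      simp [Ne.symm hb]
    · simp
  have hs : ∑ i, g i = 0 := by
    have := hc l
    simpa [l, Nat.sub_add_cancel hn] using this
  have hlt : ∀ j : Fin n, (j : ℕ) + 1 < n → g j = 0 := by
    intro j hj
    have := hc j
    rw [hs, if_pos hj] at this
    have hn' : (n : ℝ) ≠ 0 := by positivity
    simpa [hn'] using this
  intro i
  by_cases hi : (i : ℕ) + 1 < n
  · exact hlt i hi
  · rw [Finset.sum_eq_single i] at hs
    · exact hs
    · intro j _ hj
      refine hlt j ?_
      have : (j : ℕ) ≠ i := fun h => hj (Fin.ext h)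
      omega
    · simp

theorem onesVec_mem_prismLattice (n : ℕ) (hn : 1 ≤ n) : onesVec n ∈ prismLattice n := by
  refine AddSubgroup.subset_closure ⟨⟨n - 1, by omega⟩, ?_⟩
  simp [latticeVec, Nat.sub_add_cancel hn]

theorem mem_prismLattice_iff (n : ℕ) (hn : 1 ≤ n) (v : Fin n → ℝ) :
    v ∈ prismLattice n ↔
      ∃ u : Fin n → ℤ, v = toReal u ∧ ∀ i j, u i ≡ u j [ZMOD n] := by
  constructor
  · intro h
    induction h using AddSubgroup.closure_induction with
    | mem x hx =>
      obtain ⟨i, rfl⟩ := hx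
      refine ⟨fun j => 1 - if (i : ℕ) + 1 < n ∧ j = i then (n : ℤ) else 0, ?_, ?_⟩
      · funext j
        rw [latticeVec_apply, toReal]
        push_cast
        rfl
      · have : ∀ j : Fin n, (1 - if (i : ℕ) + 1 < n ∧ j = i then (n : ℤ) else 0) ≡ 1 [ZMOD n] := by
          intro j
          split_ifs
          · simp [Int.modEq_iff_dvd]
          · simp [Int.ModEq.refl]
        exact fun j k => (this j).trans (this k).symm
    | zero => exact ⟨0, by ext; simp [toReal], fun _ _ => .refl _⟩
    | add x y _ _ hx hy =>
      obtain ⟨u, rfl, hu⟩ := hx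
      obtain ⟨w, rfl, hw⟩ := hy
      exact ⟨u + w, by ext; simp [toReal], fun i j => (hu i j).add (hw i j)⟩
    | neg x _ hx =>
      obtain ⟨u, rfl, hu⟩ := hx
      exact ⟨-u, by ext; simp [toReal], fun i j => (hu i j).neg⟩
  · rintro ⟨u, rfl, hu⟩
    let l : Fin n := ⟨n - 1, by omega⟩
    have hk : ∀ i, ∃ k : ℤ, u i - u l = n * k := fun i => (hu l i).dvd
    choose k hk using hk
    have hn' : (n : ℤ) ≠ 0 := by positivity
    have hkl : ∀ i : Fin n, ¬ (i : ℕ) + 1 < n → k i = 0 := by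
      intro i hi
      have : i = l := Fin.ext (show (i : ℕ) = n - 1 by omega)
      have h := hk i
      rw [this, sub_self] at h
      rw [this]
      exact (mul_eq_zero.mp h.symm).resolve_left hn'
    -- The difference `(1, …, 1) - eᵢ` is `n` times the `i`-th unit vector. The last index
    -- contributes zero on both sides.
    have e : toReal u = u l • onesVec n + ∑ i, k i • (onesVec n - latticeVec n i) := by
      funext j
      have hj : (u j : ℝ) - u l = n * k j := by exact_mod_cast hk j
      simp only [toReal, Pi.add_apply, Finset.sum_apply, Pi.sub_apply, onesVec,
        latticeVec_apply, zsmul_eq_mul, Pi.mul_apply, Pi.intCast_apply, sub_sub_cancel]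
      rw [Finset.sum_eq_single j]
      · by_cases h : (j : ℕ) + 1 < n
        · simp only [h, and_self, if_true, mul_one]
          linarith
        · rw [hkl j h, Int.cast_zero, mul_zero] at hj
          simp only [h, false_and, if_false, mul_zero]
          linarith
      · intro b _ hb
        simp [Ne.symm hb]
      · simp
    rw [e]
    refine add_mem (zsmul_mem (onesVec_mem_prismLattice n hn) _) (sum_mem fun i _ => zsmul_mem ?_ _)
    exact sub_mem (onesVec_mem_prismLattice n hn) (AddSubgroup.subset_closure ⟨i, rfl⟩)

/-! ### Dimension of the permutohedron. -/

/-- The sum of the coordinates as a linear functional. -/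
def coordSum (n : ℕ) : (Fin n → ℝ) →ₗ[ℝ] ℝ := ∑ i, LinearMap.proj i

theorem coordSum_apply (n : ℕ) (x : Fin n → ℝ) : coordSum n x = ∑ i, x i := by
  simp [coordSum]

theorem vectorSpan_permutohedron (n : ℕ) :
    vectorSpan ℝ (permutohedron n) = LinearMap.ker (coordSum n) := by
  have h0 : vectorSpan ℝ (permutohedron n) = vectorSpan ℝ
      (Set.range fun (σ : Equiv.Perm (Fin n)) (i : Fin n) => ((σ i : ℕ) : ℝ) + 1) := by
    rw [permutohedron, ← direction_affineSpan, affineSpan_convexHull, direction_affineSpan]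
  rw [h0]
  apply le_antisymm
  · rw [vectorSpan, Submodule.span_le]
    rintro _ ⟨_, ⟨σ, rfl⟩, _, ⟨ρ, rfl⟩, rfl⟩
    simp only [SetLike.mem_coe, LinearMap.mem_ker, coordSum_apply, vsub_eq_sub, Pi.sub_apply,
      Finset.sum_sub_distrib]
    rw [Equiv.sum_comp σ (fun i : Fin n => ((i : ℕ) : ℝ) + 1),
      Equiv.sum_comp ρ (fun i : Fin n => ((i : ℕ) : ℝ) + 1), sub_self]
  · intro x hx
    rw [LinearMap.mem_ker, coordSum_apply] at hx
    -- The identity vertex minus its image under the transposition of `i` and `j` is `(i - j)` times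
    -- this vector.
    have hd : ∀ i j : Fin n, (Pi.single i 1 - Pi.single j 1 : Fin n → ℝ) ∈ vectorSpan ℝ
        (Set.range fun (σ : Equiv.Perm (Fin n)) (i : Fin n) => ((σ i : ℕ) : ℝ) + 1) := by
      intro i j
      by_cases hij : i = j
      · simp [hij]
      have hne : ((i : ℕ) : ℝ) - (j : ℕ) ≠ 0 := by
        rw [sub_ne_zero]
        exact fun h => hij (Fin.ext (Nat.cast_injective h))
      have hm := vsub_mem_vectorSpan ℝ (Set.mem_range_self
        (f := fun (σ : Equiv.Perm (Fin n)) (i : Fin n) => ((σ i : ℕ) : ℝ) + 1) 1)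
        (Set.mem_range_self (Equiv.swap i j))
      have := Submodule.smul_mem _ (((i : ℕ) : ℝ) - (j : ℕ))⁻¹ hm
      convert this using 1
      rw [eq_inv_smul_iff₀ hne]
      funext k
      simp only [Pi.smul_apply, Pi.sub_apply, smul_eq_mul, vsub_eq_sub, Equiv.Perm.one_apply]
      by_cases hki : k = i
      · subst hki
        simp [hij]
      · by_cases hkj : k = j
        · subst hkj
          simp [hki]
        · simp [hki, hkj, Equiv.swap_apply_of_ne_of_ne]
    rcases n with _ | m
    · rw [Subsingleton.elim x 0]
      exact zero_mem _
    · have e : x = ∑ i, x i • (Pi.single i 1 - Pi.single 0 1 : Fin (m + 1) → ℝ) := by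
        simp only [smul_sub, Finset.sum_sub_distrib]
        rw [← Finset.sum_smul, hx, zero_smul, sub_zero]
        exact pi_eq_sum_univ' x
      rw [e]
      exact sum_mem fun i _ => Submodule.smul_mem _ _ (hd i 0)

theorem onesVec_notMem_vectorSpan_permutohedron (n : ℕ) (hn : 1 ≤ n) :
    onesVec n ∉ vectorSpan ℝ (permutohedron n) := by
  rw [vectorSpan_permutohedron, LinearMap.mem_ker, coordSum_apply]
  simp only [onesVec, Finset.sum_const, Finset.card_univ, Fintype.card_fin, nsmul_eq_mul, mul_one]
  positivity

theorem finrank_vectorSpan_permutohedron (n : ℕ) (hn : 1 ≤ n) :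
    Module.finrank ℝ (vectorSpan ℝ (permutohedron n)) + 1 = n := by
  have hne : coordSum n ≠ 0 := by
    intro h
    refine onesVec_notMem_vectorSpan_permutohedron n hn ?_
    rw [vectorSpan_permutohedron, h]
    simp
  rw [vectorSpan_permutohedron]
  simpa using Module.Dual.finrank_ker_add_one_of_ne_zero hne

/-! ### Euclidean distance and extreme points. -/

/-- The squared Euclidean distance of two vectors. -/
def sqDist {ι : Type*} [Fintype ι] (x y : ι → ℝ) : ℝ := ∑ i, (x i - y i) ^ 2

theorem sqDist_convexCombination {ι : Type*} [Fintype ι] (x y p : ι → ℝ) {α β : ℝ}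
    (h : α + β = 1) :
    sqDist (α • x + β • y) p = α * sqDist x p + β * sqDist y p - α * β * sqDist x y := by
  obtain rfl : β = 1 - α := by linarith
  simp only [sqDist, Finset.mul_sum, ← Finset.sum_add_distrib, ← Finset.sum_sub_distrib]
  refine Finset.sum_congr rfl fun i _ => ?_
  simp only [Pi.add_apply, Pi.smul_apply, smul_eq_mul]
  ring

theorem sqDist_nonneg {ι : Type*} [Fintype ι] (x y : ι → ℝ) : 0 ≤ sqDist x y :=
  Finset.sum_nonneg fun _ _ => sq_nonneg _

theorem sqDist_eq_zero {ι : Type*} [Fintype ι] {x y : ι → ℝ} (h : sqDist x y = 0) : x = y := by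
  funext i
  rw [sqDist, Finset.sum_eq_zero_iff_of_nonneg fun _ _ => sq_nonneg _] at h
  exact sub_eq_zero.mp (pow_eq_zero_iff two_ne_zero |>.mp (h i (Finset.mem_univ i)))

theorem convex_sqDist_le {ι : Type*} [Fintype ι] (p : ι → ℝ) (r : ℝ) :
    Convex ℝ {x | sqDist x p ≤ r} := by
  intro x hx y hy α β hα hβ h
  simp only [Set.mem_ofPred_eq] at hx hy ⊢
  rw [sqDist_convexCombination _ _ _ h]
  have h1 := mul_le_mul_of_nonneg_left hx hα
  have h2 := mul_le_mul_of_nonneg_left hy hβ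
  have h3 := mul_nonneg (mul_nonneg hα hβ) (sqDist_nonneg x y)
  have h4 : α * r + β * r = r := by rw [← add_mul, h, one_mul]
  linarith

/-- Balls are strictly convex: a proper convex combination of two distinct points of the ball lies
strictly inside the sphere carrying `S`. -/
theorem extremePoints_convexHull_of_sqDist_eq {ι : Type*} [Fintype ι] {S : Set (ι → ℝ)}
    {p : ι → ℝ} {r : ℝ} (hS : ∀ x ∈ S, sqDist x p = r) :
    Set.extremePoints ℝ (convexHull ℝ S) = S := by
  refine Set.Subset.antisymm extremePoints_convexHull_subset fun x hx => ?_
  have hull : convexHull ℝ S ⊆ {x | sqDist x p ≤ r} :=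
    convexHull_min (fun y hy => (hS y hy).le) (convex_sqDist_le p r)
  refine mem_extremePoints_iff_left.mpr ⟨subset_convexHull ℝ S hx, ?_⟩
  rintro y hy z hz ⟨α, β, hα, hβ, h, rfl⟩
  have hc := sqDist_convexCombination y z p h
  rw [hS _ hx] at hc
  have h1 := mul_le_mul_of_nonneg_left (hull hy) hα.le
  have h2 := mul_le_mul_of_nonneg_left (hull hz) hβ.le
  have h3 : α * r + β * r = r := by rw [← add_mul, h, one_mul]
  have h4 := mul_pos hα hβ
  have h5 : sqDist y z = 0 := by
    refine le_antisymm ?_ (sqDist_nonneg y z)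
    by_contra hlt
    have := mul_pos h4 (not_le.mp hlt)
    linarith
  rw [sqDist_eq_zero h5, ← add_smul, h, one_smul]

/-! ### Vertices of the prisms. -/

/-- The vertices of the prism over the permutohedron. -/
def permPrismVertices (n : ℕ) : Set (Fin n → ℝ) :=
  (Set.range fun (σ : Equiv.Perm (Fin n)) (i : Fin n) => ((σ i : ℕ) : ℝ) + 1) + {0, onesVec n}

theorem permPrism_eq_convexHull (n : ℕ) :
    permPrism n = convexHull ℝ (permPrismVertices n) := by
  rw [permPrism, prism, permutohedron, permPrismVertices, convexHull_add, convexHull_pair]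

theorem finite_permPrismVertices (n : ℕ) : (permPrismVertices n).Finite :=
  (Set.finite_range _).add (Set.toFinite _)

/-- Permutations of `(1, …, n)` translated by `0` or `(1, …, 1)`. -/
theorem mem_permPrismVertices_iff (n : ℕ) (x : Fin n → ℝ) :
    x ∈ permPrismVertices n ↔ ∃ (σ : Equiv.Perm (Fin n)) (b : Fin n → ℤ), x = toReal b ∧
      ((∀ i, b i = (σ i : ℕ) + 1) ∨ ∀ i, b i = (σ i : ℕ) + 2) := by
  rw [permPrismVertices, Set.mem_add]
  constructor
  · rintro ⟨_, ⟨σ, rfl⟩, e, he, rfl⟩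
    rcases he with rfl | rfl
    · exact ⟨σ, fun i => (σ i : ℕ) + 1, by ext; simp [toReal], .inl fun _ => rfl⟩
    · refine ⟨σ, fun i => (σ i : ℕ) + 2, ?_, .inr fun _ => rfl⟩
      ext
      simp only [toReal, onesVec, Pi.add_apply]
      push_cast
      ring
  · rintro ⟨σ, b, rfl, h | h⟩
    · exact ⟨_, ⟨σ, rfl⟩, 0, by simp, by ext; simp [toReal, h]⟩
    · refine ⟨_, ⟨σ, rfl⟩, onesVec n, by simp, ?_⟩
      ext
      simp only [toReal, onesVec, Pi.add_apply, h]
      push_cast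
      ring

theorem exists_perm_of_not_intModEq {n : ℕ} (hn : 1 ≤ n) {b : Fin n → ℤ}
    (hb : ∀ i j : Fin n, i ≠ j → ¬ b i ≡ b j [ZMOD n]) :
    ∃ (σ : Equiv.Perm (Fin n)) (k : Fin n → ℤ), ∀ i, b i = (σ i : ℕ) + 1 + n * k i := by
  have hn0 : (0 : ℤ) < n := by exact_mod_cast hn
  have hlt : ∀ i, ((b i - 1) % n).toNat < n := by
    intro i
    have h1 := Int.emod_nonneg (b i - 1) hn0.ne'
    have h2 := Int.emod_lt_of_pos (b i - 1) hn0
    omega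
  let f : Fin n → Fin n := fun i => ⟨((b i - 1) % n).toNat, hlt i⟩
  have hf : ∀ i, ((f i : ℕ) : ℤ) = (b i - 1) % n := fun i =>
    Int.toNat_of_nonneg (Int.emod_nonneg _ hn0.ne')
  have hinj : Function.Injective f := by
    intro i j hij
    by_contra hne
    refine hb i j hne ?_
    have h : (b i - 1) % n = (b j - 1) % n := by rw [← hf, ← hf, hij]
    simpa using Int.ModEq.add_right 1 h
  refine ⟨Equiv.ofBijective f (Finite.injective_iff_bijective.mp hinj),
    fun i => (b i - 1) / n, fun i => ?_⟩
  rw [Equiv.ofBijective_apply, hf]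
  have := Int.emod_add_mul_ediv (b i - 1) n
  linarith

/-- The centre of the prism over the permutohedron. -/
noncomputable def prismCenter (n : ℕ) : Fin n → ℝ := fun _ => (n : ℝ) / 2 + 1

/-- Reducing each coordinate into `{1, …, n}` does not increase its distance to `n / 2 + 1`, and the
reduced coordinates form a permutation of `1, …, n`. -/
theorem le_sqDist_prismCenter {n : ℕ} (hn : 1 ≤ n) {b : Fin n → ℤ}
    (hb : ∀ i j : Fin n, i ≠ j → ¬ b i ≡ b j [ZMOD n]) :
    ∑ k : Fin n, ((k : ℝ) - n / 2) ^ 2 ≤ sqDist (toReal b) (prismCenter n) := by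
  obtain ⟨σ, k, h⟩ := exists_perm_of_not_intModEq hn hb
  rw [← Equiv.sum_comp σ, sqDist]
  refine Finset.sum_le_sum fun i _ => ?_
  -- This is the difference of the two squares; it is nonnegative because `|2 σ i - n| ≤ n`.
  have hz : 0 ≤ (n * k i) * (2 * (σ i : ℕ) - n + n * k i) := by
    have h1 : ((σ i : ℕ) : ℤ) < n := by exact_mod_cast (σ i).2
    rcases lt_trichotomy (k i) 0 with hk | hk | hk
    · apply mul_nonneg_of_nonpos_of_nonpos <;> nlinarith
    · simp [hk]
    · apply mul_nonneg <;> nlinarith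
  have hr : (0 : ℝ) ≤ (n * k i) * (2 * (σ i : ℕ) - n + n * k i) := by exact_mod_cast hz
  simp only [toReal, prismCenter, h]
  push_cast
  linarith

theorem sqDist_prismCenter_of_mem_permPrismVertices {n : ℕ} {x : Fin n → ℝ}
    (hx : x ∈ permPrismVertices n) :
    sqDist x (prismCenter n) = ∑ k : Fin n, ((k : ℝ) - n / 2) ^ 2 := by
  obtain ⟨σ, b, rfl, h | h⟩ := (mem_permPrismVertices_iff n x).mp hx
  · rw [← Equiv.sum_comp σ, sqDist]
    refine Finset.sum_congr rfl fun i _ => ?_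
    simp only [toReal, prismCenter, h]
    push_cast
    ring
  -- The reflection `k ↦ n - 1 - k` turns `k - n / 2` into `-(k + 1 - n / 2)`, exchanging the two
  -- bases.
  · rw [← Equiv.sum_comp Fin.revPerm, ← Equiv.sum_comp σ, sqDist]
    refine Finset.sum_congr rfl fun i _ => ?_
    have : ((Fin.revPerm (σ i) : ℕ) : ℝ) + (σ i : ℕ) + 1 = n := by
      have := (σ i).2
      rw [Fin.revPerm_apply, Fin.val_rev]
      norm_cast
      omega
    rw [← this]
    simp only [toReal, prismCenter, h, ← this]
    push_cast
    ring

theorem extremePoints_vadd_permPrism (n : ℕ) (v : Fin n → ℝ) :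
    Set.extremePoints ℝ (v +ᵥ permPrism n) = v +ᵥ permPrismVertices n := by
  rw [permPrism_eq_convexHull, ← convexHull_vadd]
  refine extremePoints_convexHull_of_sqDist_eq (p := v + prismCenter n)
    (r := ∑ k : Fin n, ((k : ℝ) - n / 2) ^ 2) ?_
  rintro _ ⟨x, hx, rfl⟩
  rw [← sqDist_prismCenter_of_mem_permPrismVertices hx]
  simp [sqDist]

theorem not_intModEq_of_mem_permPrismVertices {n : ℕ} {b : Fin n → ℤ}
    (hb : toReal b ∈ permPrismVertices n) (i j : Fin n) (hij : i ≠ j) :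
    ¬ b i ≡ b j [ZMOD n] := by
  obtain ⟨σ, c, hc, h⟩ := (mem_permPrismVertices_iff n _).mp hb
  obtain rfl : b = c := by
    funext k
    exact Int.cast_injective (congrFun hc k)
  intro hm
  refine hij (σ.injective (Fin.eq_of_intModEq ?_))
  rcases h with h | h
  all_goals
    rw [h, h] at hm
    exact Int.ModEq.add_right_cancel' _ hm

theorem iUnion_extremePoints_vadd_permPrism (n : ℕ) (hn : 1 ≤ n) :
    (⋃ v : prismLattice n, Set.extremePoints ℝ ((v : Fin n → ℝ) +ᵥ permPrism n)) =
      toReal '' {b : Fin n → ℤ | ∀ i j : Fin n, i ≠ j → ¬ b i ≡ b j [ZMOD n]} := by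
  ext x
  simp only [extremePoints_vadd_permPrism, Set.mem_iUnion, Subtype.exists, Set.mem_image,
    Set.mem_ofPred_eq, exists_prop]
  constructor
  · rintro ⟨v, hv, y, hy, rfl⟩
    obtain ⟨u, rfl, hu⟩ := (mem_prismLattice_iff n hn v).mp hv
    obtain ⟨-, b, rfl, -⟩ := (mem_permPrismVertices_iff n y).mp hy
    refine ⟨u + b, fun i j hij hm => ?_, by ext; simp [toReal]⟩
    exact not_intModEq_of_mem_permPrismVertices hy i j hij ((hu i j).add_left_cancel hm)
  · rintro ⟨b, hb, rfl⟩
    obtain ⟨σ, k, h⟩ := exists_perm_of_not_intModEq hn hb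
    refine ⟨toReal fun i => n * k i, (mem_prismLattice_iff n hn _).mpr ⟨_, rfl, ?_⟩,
      toReal fun i => (σ i : ℕ) + 1, (mem_permPrismVertices_iff n _).mpr ⟨σ, _, rfl, ?_⟩, ?_⟩
    · intro i j
      rw [Int.modEq_iff_dvd]
      exact ⟨k j - k i, by ring⟩
    · exact .inl fun _ => rfl
    · ext i
      simp only [vadd_eq_add, Pi.add_apply, toReal, h i]
      push_cast
      ring

/-! ### The prism as a Voronoi cell. -/

/-- Summation by parts: the increments of `Y` are nonnegative and multiply nonpositive partial sums
of `d` with a minus sign. -/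
theorem mul_sum_range_le_sum_range_mul (Y d : ℕ → ℝ) (n : ℕ)
    (hY : ∀ k, k + 1 < n → Y k ≤ Y (k + 1)) (hd : ∀ j ≤ n, ∑ k ∈ Finset.range j, d k ≤ 0) :
    Y (n - 1) * ∑ k ∈ Finset.range n, d k ≤ ∑ k ∈ Finset.range n, Y k * d k := by
  induction n with
  | zero => simp
  | succ m ih =>
    have h := ih (fun k hk => hY k (by omega)) (fun j hj => hd j (by omega))
    rw [Finset.sum_range_succ, Finset.sum_range_succ, Nat.add_sub_cancel, mul_add]
    have hD := hd m (by omega)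
    rcases m with _ | m
    · simp
    · have := mul_le_mul_of_nonpos_right (hY m (by omega)) hD
      rw [Nat.add_sub_cancel] at h
      linarith

theorem sum_range_natCast (t : ℕ) : ∑ k ∈ Finset.range t, (k : ℝ) = t * (t - 1) / 2 := by
  induction t with
  | zero => simp
  | succ t ih =>
    rw [Finset.sum_range_succ, ih]
    push_cast
    ring

theorem sum_ite_symm_lt {n t : ℕ} (ht : t ≤ n) (π : Equiv.Perm (Fin n)) (g : Fin n → ℝ) :
    ∑ i, (if (π.symm i : ℕ) < t then g i else 0) =
      ∑ k ∈ Finset.range t, if h : k < n then g (π ⟨k, h⟩) else 0 := by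
  have e : Finset.range t = (Finset.range n).filter (· < t) := by
    ext k
    simp only [Finset.mem_range, Finset.mem_filter]
    omega
  rw [e, Finset.sum_filter, Finset.sum_range, ← Equiv.sum_comp π]
  simp

theorem sqDist_sub_sqDist {ι : Type*} [Fintype ι] (x p q : ι → ℝ) :
    sqDist x p - sqDist x q =
      2 * ∑ i, (q i - p i) * x i + (∑ i, p i ^ 2 - ∑ i, q i ^ 2) := by
  simp only [sqDist, Finset.mul_sum, ← Finset.sum_add_distrib, ← Finset.sum_sub_distrib]
  exact Finset.sum_congr rfl fun i _ => by ring

/-- The quadratic terms cancel, so the set is a half-space, or everything if `p = q`. -/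
theorem convex_sqDist_le_sqDist {ι : Type*} [Fintype ι] (p q : ι → ℝ) :
    Convex ℝ {x | sqDist x p ≤ sqDist x q} := by
  intro x hx y hy α β hα hβ h
  simp only [Set.mem_ofPred_eq] at hx hy ⊢
  rw [sqDist_convexCombination _ _ _ h, sqDist_convexCombination _ _ _ h]
  have h1 := mul_le_mul_of_nonneg_left hx hα
  have h2 := mul_le_mul_of_nonneg_left hy hβ
  linarith

/-- The Voronoi cell of the lattice `prismLattice n` translated by `prismCenter n`, around the
translate of `v`. -/
def latticeCell (n : ℕ) (v : Fin n → ℝ) : Set (Fin n → ℝ) :=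
  {x | ∀ u ∈ prismLattice n, sqDist x (prismCenter n + v) ≤ sqDist x (prismCenter n + u)}

theorem permPrism_subset_latticeCell {n : ℕ} (hn : 1 ≤ n) : permPrism n ⊆ latticeCell n 0 := by
  rw [permPrism_eq_convexHull]
  intro x hx u hu
  refine convexHull_min (fun y hy => ?_) (convex_sqDist_le_sqDist _ _) hx
  obtain ⟨-, b, rfl, -⟩ := (mem_permPrismVertices_iff n y).mp hy
  obtain ⟨w, rfl, hw⟩ := (mem_prismLattice_iff n hn u).mp hu
  have hb : ∀ i j : Fin n, i ≠ j → ¬ (b - w) i ≡ (b - w) j [ZMOD n] := by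
    intro i j hij hm
    refine not_intModEq_of_mem_permPrismVertices hy i j hij ?_
    simpa using hm.add (hw i j)
  have e : sqDist (toReal b) (prismCenter n + toReal w) =
      sqDist (toReal (b - w)) (prismCenter n) := by
    refine Finset.sum_congr rfl fun i _ => ?_
    simp only [toReal, Pi.add_apply, Pi.sub_apply]
    push_cast
    ring
  rw [Set.mem_ofPred_eq, e, add_zero, sqDist_prismCenter_of_mem_permPrismVertices hy]
  exact le_sqDist_prismCenter hn hb

theorem two_mul_sum_le_of_mem_latticeCell {n : ℕ} {x : Fin n → ℝ} (hx : x ∈ latticeCell n 0)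
    {u : Fin n → ℝ} (hu : u ∈ prismLattice n) :
    2 * ∑ i, u i * (x i - prismCenter n i) ≤ ∑ i, u i ^ 2 := by
  have h := hx u hu
  rw [← sub_nonneg] at h ⊢
  convert h using 1
  simp only [sqDist, Finset.mul_sum, ← Finset.sum_sub_distrib]
  refine Finset.sum_congr rfl fun i _ => ?_
  simp only [Pi.add_apply, Pi.zero_apply]
  ring

theorem abs_sum_le_of_mem_latticeCell {n : ℕ} (hn : 1 ≤ n) {x : Fin n → ℝ}
    (hx : x ∈ latticeCell n 0) : |∑ i, (x i - prismCenter n i)| ≤ n / 2 := by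
  have h1 := two_mul_sum_le_of_mem_latticeCell hx (onesVec_mem_prismLattice n hn)
  have h2 := two_mul_sum_le_of_mem_latticeCell hx (neg_mem (onesVec_mem_prismLattice n hn))
  simp only [onesVec, Pi.neg_apply, one_mul, neg_mul, Finset.sum_neg_distrib, one_pow, even_two,
    Even.neg_pow, Finset.sum_const, Finset.card_univ, Fintype.card_fin, nsmul_eq_mul,
    mul_one] at h1 h2
  rw [abs_le]
  constructor <;> linarith

/-- The inequality of the Voronoi cell given by the lattice vector `t (1, …, 1) - n 1_T`, where `T`
consists of the first `t` positions in the order `π`. -/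
theorem le_sum_prefix_of_mem_latticeCell {n t : ℕ} (hn : 1 ≤ n) (ht : t ≤ n) {x : Fin n → ℝ}
    (hx : x ∈ latticeCell n 0) (π : Equiv.Perm (Fin n)) :
    t * (∑ i, (x i - prismCenter n i)) / n - t * (n - t) / 2 ≤
      ∑ k ∈ Finset.range t,
        if h : k < n then x (π ⟨k, h⟩) - prismCenter n (π ⟨k, h⟩) else 0 := by
  let u : Fin n → ℤ := fun i => t - if (π.symm i : ℕ) < t then (n : ℤ) else 0
  have hu : toReal u ∈ prismLattice n := by
    refine (mem_prismLattice_iff n hn _).mpr ⟨u, rfl, ?_⟩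
    have : ∀ i, u i ≡ t [ZMOD n] := by
      intro i
      simp only [u]
      split_ifs
      · simp [Int.modEq_iff_dvd]
      · simp [Int.ModEq.refl]
    exact fun i j => (this i).trans (this j).symm
  have hui : ∀ i, toReal u i = t - n * if (π.symm i : ℕ) < t then (1 : ℝ) else 0 := by
    intro i
    simp only [toReal, u]
    split_ifs <;> simp
  have h := two_mul_sum_le_of_mem_latticeCell hx hu
  have hcard : ∑ i, (if (π.symm i : ℕ) < t then (1 : ℝ) else 0) = t := by
    rw [sum_ite_symm_lt ht π fun _ => 1]
    rw [Finset.sum_congr rfl fun k hk => dif_pos ((Finset.mem_range.mp hk).trans_le ht)]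
    simp
  have hsq : ∑ i, toReal u i ^ 2 = n * (t * (n - t)) := by
    have : ∀ i, toReal u i ^ 2 = (t : ℝ) ^ 2 +
        (n ^ 2 - 2 * t * n) * if (π.symm i : ℕ) < t then (1 : ℝ) else 0 := by
      intro i
      rw [hui]
      split_ifs <;> ring
    simp only [this, Finset.sum_add_distrib, ← Finset.mul_sum, hcard, Finset.sum_const,
      Finset.card_univ, Fintype.card_fin, nsmul_eq_mul]
    ring
  have hlin : ∑ i, toReal u i * (x i - prismCenter n i) =
      t * ∑ i, (x i - prismCenter n i) - n * ∑ k ∈ Finset.range t,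
        if h : k < n then x (π ⟨k, h⟩) - prismCenter n (π ⟨k, h⟩) else 0 := by
    rw [← sum_ite_symm_lt ht π fun i => x i - prismCenter n i, Finset.mul_sum, Finset.mul_sum,
      ← Finset.sum_sub_distrib]
    refine Finset.sum_congr rfl fun i _ => ?_
    rw [hui]
    split_ifs <;> ring
  rw [hsq, hlin] at h
  have hn0 : (0 : ℝ) < n := by exact_mod_cast hn
  rw [sub_le_iff_le_add, div_le_iff₀ hn0]
  linarith

/-- The vertex is ordered like `y`, as in the rearrangement inequality, and lies on the base
selected by the sign of `∑ y`. -/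
theorem exists_vertex_sum_mul_le {n : ℕ} (hn : 1 ≤ n) {x : Fin n → ℝ}
    (hx : x ∈ latticeCell n 0) (y : Fin n → ℝ) :
    ∃ p ∈ permPrismVertices n, ∑ i, y i * x i ≤ ∑ i, y i * p i := by
  -- The mean of `x` minus the centre lies in `[-1/2, 1/2]`, so the first factor is nonnegative for
  -- `ε = 1` and nonpositive for `ε = 0`.
  obtain ⟨ε, hε, hεy⟩ : ∃ ε : ℝ, (ε = 0 ∨ ε = 1) ∧
      0 ≤ (ε - 1 / 2 - (∑ i, (x i - prismCenter n i)) / n) * ∑ i, y i := by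
    have hn0 : (0 : ℝ) < n := by exact_mod_cast hn
    have habs := abs_le.mp (abs_sum_le_of_mem_latticeCell hn hx)
    have h1 : (∑ i, (x i - prismCenter n i)) / n ≤ 1 / 2 := by
      rw [div_le_iff₀ hn0]
      linarith
    have h2 : -(1 / 2) ≤ (∑ i, (x i - prismCenter n i)) / n := by
      rw [le_div_iff₀ hn0]
      linarith
    rcases le_total 0 (∑ i, y i) with h | h
    · exact ⟨1, .inr rfl, mul_nonneg (by linarith) h⟩
    · exact ⟨0, .inl rfl, mul_nonneg_of_nonpos_of_nonpos (by linarith) h⟩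
  set m := (∑ i, (x i - prismCenter n i)) / n with hm
  let π : Equiv.Perm (Fin n) := Tuple.sort y
  have hmono : Monotone (y ∘ π) := Tuple.monotone_sort y
  let p : Fin n → ℝ := fun i => (π.symm i : ℕ) + 1 + ε
  have hp : p ∈ permPrismVertices n := by
    refine Set.mem_add.mpr ⟨_, ⟨π.symm, rfl⟩, fun _ => ε, ?_, rfl⟩
    rcases hε with rfl | rfl
    · exact .inl rfl
    · exact .inr rfl
  refine ⟨p, hp, ?_⟩
  let Y : ℕ → ℝ := fun k => if h : k < n then y (π ⟨k, h⟩) else 0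
  let z : ℕ → ℝ := fun k =>
    if h : k < n then x (π ⟨k, h⟩) - prismCenter n (π ⟨k, h⟩) else 0
  -- This is `p - x` in sorted order with its mean `ε - 1 / 2 - m` removed, so the total sum
  -- vanishes; the cell inequalities make the partial sums nonpositive.
  let d : ℕ → ℝ := fun k => k - (n - 1) / 2 + m - z k
  have hd : ∀ j, ∑ k ∈ Finset.range j, d k =
      -(j * (n - j) / 2) + j * m - ∑ k ∈ Finset.range j, z k := by
    intro j
    simp only [d, Finset.sum_sub_distrib, Finset.sum_add_distrib, sum_range_natCast,
      Finset.sum_const, Finset.card_range, nsmul_eq_mul]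
    ring
  have hz : ∑ k ∈ Finset.range n, z k = n * m := by
    have hn0 : (n : ℝ) ≠ 0 := by positivity
    rw [hm, mul_div_cancel₀ _ hn0, Finset.sum_range,
      ← Equiv.sum_comp π fun i => x i - prismCenter n i]
    simp [z]
  have key := mul_sum_range_le_sum_range_mul Y d n ?_ ?_
  · rw [hd n, hz, sub_self, mul_zero, zero_div, neg_zero, zero_add, sub_self, mul_zero] at key
    have e : ∑ i, y i * p i - ∑ i, y i * x i =
        ∑ k ∈ Finset.range n, Y k * d k + (ε - 1 / 2 - m) * ∑ i, y i := by
      rw [Finset.sum_range, ← Finset.sum_sub_distrib, Finset.mul_sum, ← Equiv.sum_comp π,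
        ← Equiv.sum_comp π (fun i => (ε - 1 / 2 - m) * y i), ← Finset.sum_add_distrib]
      refine Finset.sum_congr rfl fun k _ => ?_
      simp only [Y, d, z, p, Fin.is_lt, dif_pos, Fin.eta, Equiv.symm_apply_apply, prismCenter]
      ring
    linarith
  · intro k hk
    simp only [Y, dif_pos hk, dif_pos (Nat.lt_of_succ_lt hk)]
    exact hmono (Fin.mk_le_mk.mpr (Nat.le_succ k))
  · intro j hj
    have := le_sum_prefix_of_mem_latticeCell hn hj hx π
    rw [mul_div_assoc, ← hm] at this
    rw [hd j]
    simp only [z]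
    linarith

theorem latticeCell_zero_subset_permPrism {n : ℕ} (hn : 1 ≤ n) :
    latticeCell n 0 ⊆ permPrism n := by
  intro x hx
  by_contra hxp
  rw [permPrism_eq_convexHull] at hxp
  obtain ⟨f, c, hf, hfx⟩ := geometric_hahn_banach_closed_point (convex_convexHull ℝ _)
    ((finite_permPrismVertices n).isClosed_convexHull ℝ) hxp
  have hfe : ∀ w : Fin n → ℝ, f w = ∑ i, f (Pi.single i 1) * w i := by
    intro w
    conv_lhs => rw [pi_eq_sum_univ' w]
    simp [mul_comm]
  obtain ⟨p, hp, hle⟩ := exists_vertex_sum_mul_le hn hx fun i => f (Pi.single i 1)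
  rw [← hfe, ← hfe] at hle
  have := hf p (subset_convexHull ℝ _ hp)
  linarith

theorem vadd_permPrism_eq_latticeCell {n : ℕ} (hn : 1 ≤ n) {v : Fin n → ℝ}
    (hv : v ∈ prismLattice n) : v +ᵥ permPrism n = latticeCell n v := by
  rw [(permPrism_subset_latticeCell hn).antisymm (latticeCell_zero_subset_permPrism hn)]
  have e : ∀ x u : Fin n → ℝ,
      sqDist (-v + x) (prismCenter n + u) = sqDist x (prismCenter n + (u + v)) := by
    intro x u
    refine Finset.sum_congr rfl fun i _ => ?_
    simp only [Pi.add_apply, Pi.neg_apply]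
    ring
  ext x
  rw [Set.mem_vadd_set_iff_neg_vadd_mem, vadd_eq_add]
  constructor
  · intro h u hu
    have := h (u - v) (sub_mem hu hv)
    rwa [e, e, zero_add, sub_add_cancel] at this
  · intro h u hu
    rw [e, e, zero_add]
    exact h _ (add_mem hu hv)

/-! ### The Voronoi tessellation. -/

theorem finite_prismLattice_norm_sub_le {n : ℕ} (hn : 1 ≤ n) (y : Fin n → ℝ) (r : ℝ) :
    {v | v ∈ prismLattice n ∧ ‖v - y‖ ≤ r}.Finite := by
  refine ((Set.finite_Icc (fun i => ⌊y i - r⌋) (fun i => ⌈y i + r⌉)).image toReal).subset ?_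
  rintro v ⟨hv, hr⟩
  obtain ⟨u, rfl, -⟩ := (mem_prismLattice_iff n hn v).mp hv
  have h : ∀ i, |(u i : ℝ) - y i| ≤ r := fun i => (norm_le_pi_norm (toReal u - y) i).trans hr
  refine ⟨u, ⟨fun i => ?_, fun i => ?_⟩, rfl⟩
  · have := (abs_le.mp (h i)).1
    exact Int.cast_le (R := ℝ).mp ((Int.floor_le _).trans (by linarith))
  · have := (abs_le.mp (h i)).2
    exact Int.cast_le (R := ℝ).mp (le_trans (by linarith) (Int.le_ceil _))

theorem norm_sub_le_sqrt_sqDist {ι : Type*} [Fintype ι] (x y : ι → ℝ) :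
    ‖x - y‖ ≤ √(sqDist x y) := by
  rw [pi_norm_le_iff_of_nonneg (Real.sqrt_nonneg _)]
  intro i
  refine Real.abs_le_sqrt ?_
  exact Finset.single_le_sum (f := fun i => (x i - y i) ^ 2) (fun _ _ => sq_nonneg _)
    (Finset.mem_univ i)

theorem exists_mem_latticeCell {n : ℕ} (hn : 1 ≤ n) (x : Fin n → ℝ) :
    ∃ v ∈ prismLattice n, x ∈ latticeCell n v := by
  let F : Set (Fin n → ℝ) :=
    {v | v ∈ prismLattice n ∧ sqDist x (prismCenter n + v) ≤ sqDist x (prismCenter n + 0)}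
  have hF : F.Finite := by
    refine (finite_prismLattice_norm_sub_le hn (x - prismCenter n)
      √(sqDist x (prismCenter n + 0))).subset ?_
    rintro v ⟨hv, h⟩
    refine ⟨hv, ?_⟩
    have := (norm_sub_le_sqrt_sqDist x (prismCenter n + v)).trans (Real.sqrt_le_sqrt h)
    rwa [norm_sub_rev, sub_sub]
  obtain ⟨v, hv, hmin⟩ := Set.exists_min_image F (fun v => sqDist x (prismCenter n + v)) hF
    ⟨0, zero_mem _, le_rfl⟩
  refine ⟨v, hv.1, fun u hu => ?_⟩
  by_cases h : sqDist x (prismCenter n + u) ≤ sqDist x (prismCenter n + 0)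
  · exact hmin u ⟨hu, h⟩
  · exact hv.2.trans (not_le.mp h).le

/-- The difference of the squared distances to the two centres is affine, at most zero on the cell
of `v`, and zero there exactly at the points shared with the cell of `w`. -/
theorem isExposed_latticeCell_inter {n : ℕ} {v w : Fin n → ℝ} (hv : v ∈ prismLattice n)
    (hw : w ∈ prismLattice n) :
    IsExposed ℝ (latticeCell n v) (latticeCell n v ∩ latticeCell n w) := by
  rintro ⟨x₀, hx₀v, hx₀w⟩
  let l : StrongDual ℝ (Fin n → ℝ) := ∑ i, (w i - v i) • ContinuousLinearMap.proj i
  have hl : ∀ x, sqDist x (prismCenter n + v) - sqDist x (prismCenter n + w) = 2 * l x +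
      (∑ i, (prismCenter n + v) i ^ 2 - ∑ i, (prismCenter n + w) i ^ 2) := by
    intro x
    rw [sqDist_sub_sqDist]
    simp [l]
  refine ⟨l, Set.ext fun x => ⟨?_, ?_⟩⟩
  · rintro ⟨hxv, hxw⟩
    refine ⟨hxv, fun y hy => ?_⟩
    have h1 := hy w hw
    have h2 := hxw v hv
    linarith [hl x, hl y]
  · rintro ⟨hxv, hx⟩
    refine ⟨hxv, fun u hu => le_trans ?_ (hxv u hu)⟩
    have h1 := hx₀w v hv
    have h2 := hx x₀ hx₀v
    linarith [hl x, hl x₀]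

theorem disjoint_interior_latticeCell {n : ℕ} {v w : Fin n → ℝ} (hv : v ∈ prismLattice n)
    (hw : w ∈ prismLattice n) (hvw : v ≠ w) :
    Disjoint (interior (latticeCell n v)) (interior (latticeCell n w)) := by
  rw [Set.disjoint_left]
  intro x hxv hxw
  have heq : ∀ y ∈ interior (latticeCell n v) ∩ interior (latticeCell n w),
      sqDist y (prismCenter n + v) - sqDist y (prismCenter n + w) = 0 := by
    rintro y ⟨hyv, hyw⟩
    exact sub_eq_zero.mpr ((interior_subset hyv w hw).antisymm (interior_subset hyw v hv))
  have hU : interior (latticeCell n v) ∩ interior (latticeCell n w) ∈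
      nhds (x + (0 : ℝ) • (w - v)) := by
    rw [zero_smul, add_zero]
    exact (isOpen_interior.inter isOpen_interior).mem_nhds ⟨hxv, hxw⟩
  -- On a common open set the affine difference of squared distances would vanish, yet it has
  -- nonzero slope in the direction `w - v`.
  have hc : Continuous fun t : ℝ => x + t • (w - v) := by fun_prop
  obtain ⟨t, htU, ht⟩ := (((hc.tendsto 0).eventually hU).filter_mono nhdsWithin_le_nhds |>.and
    (self_mem_nhdsWithin : Set.Ioi (0 : ℝ) ∈ nhdsWithin 0 (Set.Ioi 0))).exists
  have h0 := heq x ⟨hxv, hxw⟩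
  have h1 := heq _ htU
  rw [sqDist_sub_sqDist] at h0 h1
  have e : ∑ i, ((prismCenter n + w) i - (prismCenter n + v) i) * (x + t • (w - v)) i =
      ∑ i, ((prismCenter n + w) i - (prismCenter n + v) i) * x i + t * sqDist w v := by
    rw [sqDist, Finset.mul_sum, ← Finset.sum_add_distrib]
    refine Finset.sum_congr rfl fun i _ => ?_
    simp only [Pi.add_apply, Pi.smul_apply, Pi.sub_apply, smul_eq_mul]
    ring
  rw [e] at h1
  have h2 : t * sqDist w v = 0 := by linarith
  exact hvw (sqDist_eq_zero ((mul_eq_zero.mp h2).resolve_left (ne_of_gt ht))).symm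

/-- The ball is for the sup norm and lattice vectors are integral, so the comparison holds in each
coordinate separately. -/
theorem ball_subset_latticeCell {n : ℕ} (hn : 1 ≤ n) {v : Fin n → ℝ} (hv : v ∈ prismLattice n) :
    Metric.ball (prismCenter n + v) (1 / 2) ⊆ latticeCell n v := by
  intro x hx u hu
  obtain ⟨a, rfl, -⟩ := (mem_prismLattice_iff n hn v).mp hv
  obtain ⟨b, rfl, -⟩ := (mem_prismLattice_iff n hn u).mp hu
  refine Finset.sum_le_sum fun i _ => ?_
  have h : |x i - (prismCenter n + toReal a) i| < 1 / 2 :=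
    (dist_le_pi_dist x (prismCenter n + toReal a) i).trans_lt hx
  simp only [Pi.add_apply, toReal] at h ⊢
  obtain ⟨h1, h2⟩ := abs_lt.mp h
  rcases lt_trichotomy (a i) (b i) with hab | hab | hab
  · have : (a i : ℝ) + 1 ≤ b i := by exact_mod_cast hab
    nlinarith
  · rw [hab]
  · have : (b i : ℝ) + 1 ≤ a i := by exact_mod_cast hab
    nlinarith

theorem locallyFinite_vadd_permPrism {n : ℕ} (hn : 1 ≤ n) :
    LocallyFinite fun v : prismLattice n => (v : Fin n → ℝ) +ᵥ permPrism n := by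
  obtain ⟨C, hC⟩ := ((finite_permPrismVertices n).isCompact_convexHull ℝ).isBounded.exists_norm_le
  rw [← permPrism_eq_convexHull] at hC
  intro x
  refine ⟨Metric.closedBall x 1, Metric.closedBall_mem_nhds x one_pos, ?_⟩
  refine ((finite_prismLattice_norm_sub_le hn x (1 + C)).preimage
    Subtype.val_injective.injOn).subset ?_
  rintro ⟨v, hv⟩ ⟨_, ⟨p, hp, rfl⟩, hy⟩
  refine ⟨hv, ?_⟩
  replace hy : ‖v + p - x‖ ≤ 1 := by simpa [dist_eq_norm] using hy
  have e : v - x = (v + p - x) - p := by abel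
  calc ‖v - x‖ = ‖(v + p - x) - p‖ := by rw [← e]
    _ ≤ ‖v + p - x‖ + ‖p‖ := norm_sub_le _ _
    _ ≤ 1 + C := add_le_add hy (hC p hp)

theorem isFaceToFaceTessellation_permPrism {n : ℕ} (hn : 1 ≤ n) :
    IsFaceToFaceTessellation
      (fun v : prismLattice n => (v : Fin n → ℝ) +ᵥ permPrism n) where
  polytope v := ⟨(v : Fin n → ℝ) +ᵥ permPrismVertices n, (finite_permPrismVertices n).vadd_set,
    by rw [convexHull_vadd, permPrism_eq_convexHull]⟩
  fullDim v := by
    rw [vadd_permPrism_eq_latticeCell hn v.2]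
    exact ⟨_, interior_maximal (ball_subset_latticeCell hn v.2) Metric.isOpen_ball
      (Metric.mem_ball_self (by norm_num))⟩
  locallyFinite := locallyFinite_vadd_permPrism hn
  cover := by
    refine Set.eq_univ_of_forall fun x => ?_
    obtain ⟨v, hv, hx⟩ := exists_mem_latticeCell hn x
    rw [← vadd_permPrism_eq_latticeCell hn hv] at hx
    exact Set.mem_iUnion.mpr ⟨⟨v, hv⟩, hx⟩
  disjointInteriors v w hvw := by
    rw [vadd_permPrism_eq_latticeCell hn v.2, vadd_permPrism_eq_latticeCell hn w.2]
    exact disjoint_interior_latticeCell v.2 w.2 (Subtype.coe_injective.ne hvw)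
  faceToFace v w _ := by
    rw [vadd_permPrism_eq_latticeCell hn v.2, vadd_permPrism_eq_latticeCell hn w.2]
    refine ⟨isExposed_latticeCell_inter v.2 w.2, ?_⟩
    rw [Set.inter_comm]
    exact isExposed_latticeCell_inter w.2 v.2

theorem mainTheorem4 (n : ℕ) (hn : 1 ≤ n) :
    -- the translate `s + 𝔄ₙ` is the set of integer points with coordinates distinct modulo `n`
    ((fun a : Fin n → ℤ => shiftVec n + a) '' frakA n =
      {b : Fin n → ℤ | ∀ i j : Fin n, i ≠ j → ¬ b i ≡ b j [ZMOD (n : ℤ)]}) ∧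
    -- the permutohedron is `(n - 1)`-dimensional, and the prism over it is nondegenerate
    (Module.finrank ℝ (vectorSpan ℝ (permutohedron n)) + 1 = n ∧
      onesVec n ∉ vectorSpan ℝ (permutohedron n)) ∧
    -- `e₁, …, eₙ₋₁, (1, …, 1)` span a lattice of full rank
    LinearIndependent ℝ (latticeVec n) ∧
    -- `s + 𝔄ₙ` is the set of all vertices of all the translated prisms
    ((fun a : Fin n → ℤ => toReal (shiftVec n + a)) '' frakA n =
      ⋃ v : prismLattice n, Set.extremePoints ℝ ((v : Fin n → ℝ) +ᵥ permPrism n)) ∧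
    -- the translated prisms tessellate the space face-to-face
    IsFaceToFaceTessellation
      (fun v : prismLattice n => (v : Fin n → ℝ) +ᵥ permPrism n) := by
  refine ⟨shiftVec_add_image_frakA n, ⟨finrank_vectorSpan_permutohedron n hn,
    onesVec_notMem_vectorSpan_permutohedron n hn⟩, linearIndependent_latticeVec n hn, ?_,
    isFaceToFaceTessellation_permPrism hn⟩
  rw [iUnion_extremePoints_vadd_permPrism n hn, ← shiftVec_add_image_frakA n, Set.image_image]
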